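/- Let $X$ be a random variable with values in a measurable space $\mathcal{X}$, let $\mathcal{T}\subseteq\mathbb{R}^k$ be compact, and let $\hat\theta\colon\mathcal{X}\times\mathcal{T}\to\mathbb{R}$ be such that $\hat\theta(\cdot,t)$ is measurable for every $t\in\mathcal{T}$, $\hat\theta(x,\cdot)$ is continuous for every $x\in\mathcal{X}$, and $\sup_{x,t}|\hat\theta(x,t)|<+\infty$. Put $\theta(t):=E(\hat\theta(X,t))$ and assume that $\theta$ has a minimum $\theta_*:=\min_{t\in\mathcal{T}}\theta(t)$. Let $\tau\colon\mathcal{X}\to\mathcal{T}$ be a measurable function with $\tau(x)\in\arg\min_{t\in\mathcal{T}}\hat\theta(x,t)$ for all $x\in\mathcal{X}$, and let $$\hat\theta_*(x):=\hat\theta(x,\tau(x))=\min_{t\in\mathcal{T}}\hat\theta(x,t),\qquad \hat\theta^*(x,x'):=\hat\theta(x,\tau(x')).$$ Let $\alpha\in(0,1)$. For $\chi_1,\dots,\chi_N,\chi'_1,\dots,\chi'_N$ independent and identically distributed with the law of $X$ (on any probability space), let $\bar Y_*$ and $S_*$ be the sample mean and the sample standard deviation (with divisor $N-1$ in the sample variance)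 of $(\hat\theta_*(\chi_i))_{i=1}^N$, let $\bar Y^*$ and $S^*$ be those of $(\hat\theta^*(\chi_i,\chi'_i))_{i=1}^N$, and let $t_{N-1}$ be the two-sided critical value of Student's t-distribution with $N-1$ degrees of freedom at confidence level $1-\alpha$, that is, $P(|T|\le t_{N-1})=1-\alpha$ for $T$ with that distribution. Then $\left[\bar Y_*-t_{N-1}\frac{S_*}{\sqrt N},\ \bar Y^*+t_{N-1}\frac{S^*}{\sqrt N}\right]$ is an approximate confidence interval for $\theta_*$ with confidence level at least $1-\alpha$, in the sense that for every $\varepsilon>0$ there is an $N_0$ such that for all $N\ge N_0$ and all such $\chi_1,\dots,\chi_N,\chi'_1,\dots,\chi'_N$, $$P\left(\bar Y_*-t_{N-1}\frac{S_*}{\sqrt N}\le\theta_*\le\bar Y^*+t_{N-1}\frac{S^*}{\sqrt N}\right)\ \ge\ 1-\alpha-\varepsilon .$$ Equivalently, the limit inferior of this probability as $N\to\infty$ is at least $1-\alpha$. -/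

import Mathlib

open MeasureTheory ProbabilityTheory

noncomputable section

/-- The sample mean of `y 0, …, y (N - 1)`. -/
def sampleMean {N : ℕ} (y : Fin N → ℝ) : ℝ :=
  (∑ i, y i) / N

/-- The sample standard deviation, with Bessel's correction `N - 1`. -/
def sampleStdDev {N : ℕ} (y : Fin N → ℝ) : ℝ :=
  √((∑ i, (y i - sampleMean y) ^ 2) / ((N : ℝ) - 1))

/-- Student's t-distribution with `ν ≥ 1` degrees of freedom: the law of
`Z₀ / √((Z₁² + ⋯ + Z_ν²) / ν)` for independent standard normal `Z₀, …, Z_ν`. -/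
def studentT (ν : ℕ) : Measure ℝ :=
  (Measure.pi fun _ : Fin (ν + 1) => gaussianReal 0 1).map
    fun z => z 0 / √((∑ i : Fin ν, z i.succ ^ 2) / ν)

/-- The two-sided critical value of the t-distribution with `ν` degrees of freedom at
confidence level `1 - α`: the `c ≥ 0` with `P(|T| ≤ c) = 1 - α`, obtained as the least `c ≥ 0`
with `P(|T| ≤ c) ≥ 1 - α`. -/
def tCritical (ν : ℕ) (α : ℝ) : ℝ :=
  sInf {c : ℝ | 0 ≤ c ∧ 1 - α ≤ (studentT ν).real (Set.Icc (-c) c)}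

/-- The lower estimator `θ̂(x, τ(x))`, which is `min_t θ̂(x, t)` when `τ(x)` is a minimiser
of `θ̂(x, ·)`. -/
def lowerEstimator {𝒳 T : Type*} (θhat : 𝒳 → T → ℝ) (τ : 𝒳 → T) (x : 𝒳) : ℝ :=
  θhat x (τ x)

/-- The upper estimator `θ̂(x, τ(x'))`. -/
def upperEstimator {𝒳 T : Type*} (θhat : 𝒳 → T → ℝ) (τ : 𝒳 → T) (x x' : 𝒳) : ℝ :=
  θhat x (τ x')

/-- The lower end point `ȳ - t_{N-1} s / √N`. -/
def lowerConfidenceLimit {N : ℕ} (α : ℝ) (y : Fin N → ℝ) : ℝ :=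
  sampleMean y - tCritical (N - 1) α * (sampleStdDev y / √N)

/-- The upper end point `ȳ + t_{N-1} s / √N`. -/
def upperConfidenceLimit {N : ℕ} (α : ℝ) (y : Fin N → ℝ) : ℝ :=
  sampleMean y + tCritical (N - 1) α * (sampleStdDev y / √N)

end

open Filter Topology

/-! The lower estimator has mean at most `θstar`, since its values lie below `θhat x t` for a
minimiser `t` of `θ`. The upper estimator has mean at least `θstar`: for fixed `x'` its mean over
`x` is `θ (τ x')`. So coverage can fail only if one of two one-sided t-intervals misses its own
mean. Each does so with asymptotic probability at most `α / 2` (`eventually_lowerConfidenceLimit`),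
and a union bound suffices, whatever the dependence between the two. The one-sided bound combines
the central limit theorem, Slutsky's lemma with a consistent sample deviation, and
`eventually_le_tCritical`. -/

theorem infinitePi_map_fin {E : Type*} [MeasurableSpace E] (ν : Measure E)
    [IsProbabilityMeasure ν] (N : ℕ) :
    (Measure.infinitePi fun _ : ℕ => ν).map (fun ω (i : Fin N) => ω i) =
      Measure.pi fun _ : Fin N => ν := by
  have h : iIndepFun (fun (i : ℕ) (ω : ℕ → E) => ω i) (Measure.infinitePi fun _ : ℕ => ν) :=
    iIndepFun_infinitePi (X := fun _ x => x) fun _ => measurable_id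
  have h' := h.precomp (g := fun i : Fin N => (i : ℕ)) Fin.val_injective
  rw [iIndepFun_iff_map_fun_eq_pi_map fun i => (measurable_pi_apply _).aemeasurable] at h'
  rw [h']
  congr 1
  funext i
  exact Measure.infinitePi_map_eval (fun _ : ℕ => ν) i

/-! ### Normal quantiles, laws of large numbers and the portmanteau bound. -/

theorem tendsto_measureReal_Icc_neg (μ : Measure ℝ) [IsProbabilityMeasure μ] :
    Tendsto (fun c : ℝ => μ.real (Set.Icc (-c) c)) atTop (𝓝 1) := by
  have hmono : Monotone fun c : ℝ => Set.Icc (-c) c := fun a b hab =>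
    Set.Icc_subset_Icc (neg_le_neg hab) hab
  have hU : ⋃ c : ℝ, Set.Icc (-c) c = Set.univ :=
    Set.eq_univ_of_forall fun x => Set.mem_iUnion.2 ⟨|x|, neg_abs_le x, le_abs_self x⟩
  have h := tendsto_measure_iUnion_atTop (μ := μ) hmono
  rw [hU, measure_univ] at h
  exact (ENNReal.tendsto_toReal ENNReal.one_ne_top).comp h

/-- Intermediate value theorem: the mass of `[-c, c]` is continuous in `c`, vanishes at `0` and
tends to `1`. -/
theorem exists_gaussianReal_Icc_eq {p : ℝ} (hp₀ : 0 ≤ p) (hp₁ : p < 1) :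
    ∃ c : ℝ, 0 ≤ c ∧ (gaussianReal 0 1).real (Set.Icc (-c) c) = p := by
  set F : ℝ → ℝ := fun c => ∫ x in (-c)..c, gaussianPDFReal 0 1 x with hF
  have hint : Integrable (gaussianPDFReal 0 1) := integrable_gaussianPDFReal 0 1
  have hFeq : ∀ c, 0 ≤ c → (gaussianReal 0 1).real (Set.Icc (-c) c) = F c := by
    intro c hc
    rw [measureReal_def, gaussianReal_apply_eq_integral _ one_ne_zero,
      ENNReal.toReal_ofReal (integral_nonneg fun x => gaussianPDFReal_nonneg 0 1 x), hF,
      integral_Icc_eq_integral_Ioc]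
    exact (intervalIntegral.integral_of_le (by linarith)).symm
  have hcont : Continuous F := by
    have h0 : Continuous fun b : ℝ => ∫ x in (0 : ℝ)..b, gaussianPDFReal 0 1 x :=
      intervalIntegral.continuous_primitive (fun _ _ => hint.intervalIntegrable) 0
    have : F = fun c => (∫ x in (0 : ℝ)..c, gaussianPDFReal 0 1 x) -
        ∫ x in (0 : ℝ)..(-c), gaussianPDFReal 0 1 x := by
      funext c
      exact (intervalIntegral.integral_interval_sub_left hint.intervalIntegrable
        hint.intervalIntegrable).symm
    rw [this]
    exact h0.sub (h0.comp continuous_neg)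
  obtain ⟨b, hb, hb0⟩ := (((tendsto_measureReal_Icc_neg (gaussianReal 0 1)).eventually
    (lt_mem_nhds hp₁)).and (eventually_ge_atTop 0)).exists
  have hmem : p ∈ Set.Icc (F 0) (F b) := ⟨by simpa [hF] using hp₀, by rw [← hFeq b hb0]; exact hb.le⟩
  obtain ⟨c, hc, hcp⟩ := intermediate_value_Icc hb0 hcont.continuousOn hmem
  exact ⟨c, hc.1, by rw [hFeq c hc.1, hcp]⟩

theorem gaussianReal_Ici_eq {c : ℝ} (hc : 0 ≤ c) :
    (gaussianReal 0 1).real (Set.Ici c) =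
      (1 - (gaussianReal 0 1).real (Set.Icc (-c) c)) / 2 := by
  set γ := gaussianReal 0 1 with hγ
  have : NullSingletonClass γ := nullSingletonClass_gaussianReal one_ne_zero
  have hsymm : γ.real (Set.Iio (-c)) = γ.real (Set.Ioi c) := by
    have h : γ.map (fun x => -x) = γ := by simp [hγ, gaussianReal_map_neg]
    rw [← h, map_measureReal_apply measurable_neg measurableSet_Iio, h]
    congr 1
    ext x
    simp
  have hIci : γ.real (Set.Ici c) = γ.real (Set.Ioi c) := measureReal_congr Ioi_ae_eq_Ici.symm
  have hcompl : (Set.Icc (-c) c)ᶜ = Set.Iio (-c) ∪ Set.Ioi c := by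
    ext x
    simp only [Set.mem_compl_iff, Set.mem_Icc, Set.mem_union, Set.mem_Iio, Set.mem_Ioi, not_and_or,
      not_le]
  have hdisj : Disjoint (Set.Iio (-c)) (Set.Ioi c) :=
    Set.disjoint_left.2 fun x hx hx' => by
      simp only [Set.mem_Iio, Set.mem_Ioi] at hx hx'
      linarith
  have h1 := probReal_compl_eq_one_sub (μ := γ) (measurableSet_Icc (a := -c) (b := c))
  rw [hcompl, measureReal_union hdisj measurableSet_Ioi, hsymm] at h1
  linarith

theorem identDistrib_eval_infinitePi {E : Type*} [MeasurableSpace E] (ν : Measure E)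
    [IsProbabilityMeasure ν] {f : E → ℝ} (hf : Measurable f) (i j : ℕ) :
    IdentDistrib (fun ω : ℕ → E => f (ω i)) (fun ω => f (ω j))
      (Measure.infinitePi fun _ => ν) (Measure.infinitePi fun _ => ν) := by
  refine IdentDistrib.comp (u := f) ⟨(measurable_pi_apply i).aemeasurable,
    (measurable_pi_apply j).aemeasurable, ?_⟩ hf
  rw [Measure.infinitePi_map_eval, Measure.infinitePi_map_eval]

theorem integral_eval_infinitePi {E : Type*} [MeasurableSpace E] (ν : Measure E)
    [IsProbabilityMeasure ν] {f : E → ℝ} (hf : Measurable f) (i : ℕ) :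
    ∫ ω, f (ω i) ∂(Measure.infinitePi fun _ : ℕ => ν) = ∫ x, f x ∂ν := by
  have h := integral_map (μ := Measure.infinitePi fun _ : ℕ => ν)
    (measurable_pi_apply i).aemeasurable hf.aestronglyMeasurable
  rw [Measure.infinitePi_map_eval] at h
  exact h.symm

theorem strong_law_infinitePi {E : Type*} [MeasurableSpace E] (ν : Measure E)
    [IsProbabilityMeasure ν] {f : E → ℝ} (hf : Measurable f) (hint : Integrable f ν)
    {g : ℕ → ℕ} (hg : g.Injective) :
    ∀ᵐ ω ∂(Measure.infinitePi fun _ : ℕ => ν),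
      Tendsto (fun n : ℕ => (∑ i ∈ Finset.range n, f (ω (g i))) / n) atTop
        (𝓝 (∫ x, f x ∂ν)) := by
  have hind : iIndepFun (fun (i : ℕ) (ω : ℕ → E) => f (ω (g i)))
      (Measure.infinitePi fun _ : ℕ => ν) :=
    (iIndepFun_infinitePi (X := fun _ => f) fun _ => hf).precomp hg
  have h := strong_law_ae_real (fun i (ω : ℕ → E) => f (ω (g i)))
    ((measurePreserving_eval_infinitePi (fun _ : ℕ => ν) (g 0)).integrable_comp_of_integrable hint)
    (fun i j hij => hind.indepFun hij)
    (fun i => identDistrib_eval_infinitePi ν hf (g i) (g 0))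
  rwa [integral_eval_infinitePi ν hf] at h

theorem MeasureTheory.TendstoInDistribution.eventually_measureReal_lt {E Ω Ω' : Type*} [MeasurableSpace E]
    [TopologicalSpace E] [OpensMeasurableSpace E] [HasOuterApproxClosed E] [MeasurableSpace Ω]
    [MeasurableSpace Ω'] {P : Measure Ω} [IsProbabilityMeasure P] {P' : Measure Ω'}
    [IsProbabilityMeasure P'] {X : ℕ → Ω → E} {Z : Ω' → E}
    (h : TendstoInDistribution X atTop Z (fun _ => P) P') {F : Set E} (hF : IsClosed F) {r : ℝ}
    (hr : (P'.map Z).real F < r) : ∀ᶠ n in atTop, (P.map (X n)).real F < r := by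
  have h1 := ProbabilityMeasure.limsup_measure_closed_le_of_tendsto h.tendsto hF
  have : IsProbabilityMeasure (P'.map Z) := Measure.isProbabilityMeasure_map h.aemeasurable_limit
  have h2 : P'.map Z F < ENNReal.ofReal r := by
    rwa [← ofReal_measureReal, ENNReal.ofReal_lt_ofReal_iff (measureReal_nonneg.trans_lt hr)]
  filter_upwards [eventually_lt_of_limsup_lt (h1.trans_lt h2)] with n hn
  exact (ENNReal.lt_ofReal_iff_toReal_lt hn.ne_top).1 hn

/-! ### Student's t-distribution for large degrees of freedom. -/

instance isProbabilityMeasure_studentT (n : ℕ) : IsProbabilityMeasure (studentT n) :=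
  Measure.isProbabilityMeasure_map (by fun_prop)

theorem studentT_eq_map_infinitePi (n : ℕ) :
    studentT n = (Measure.infinitePi fun _ : ℕ => gaussianReal 0 1).map
      fun ω => ω 0 / √((∑ i ∈ Finset.range n, ω (i + 1) ^ 2) / n) := by
  rw [studentT, ← infinitePi_map_fin, Measure.map_map (by fun_prop) (by fun_prop)]
  congr 1
  funext ω
  simp [Fin.sum_univ_eq_sum_range (fun i => ω (i + 1) ^ 2)]

theorem integral_sq_gaussianReal : ∫ x, x ^ 2 ∂(gaussianReal 0 1) = 1 := by
  have h := variance_fun_id_gaussianReal (μ := 0) (v := 1)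
  rw [variance_eq_integral (by fun_prop), integral_id_gaussianReal] at h
  simpa using h

/-- With all t-variables built on one sequence space, the denominator tends to `1` almost surely by
the strong law, so they converge to the normal variable `ω 0`. -/
theorem eventually_studentT_Icc_lt {c r : ℝ}
    (h : (gaussianReal 0 1).real (Set.Icc (-c) c) < r) :
    ∀ᶠ n in atTop, (studentT n).real (Set.Icc (-c) c) < r := by
  have hint : Integrable (fun x : ℝ => x ^ 2) (gaussianReal 0 1) :=
    (memLp_id_gaussianReal 2).integrable_sq
  have hae := strong_law_infinitePi (gaussianReal 0 1) (f := fun x => x ^ 2) (by fun_prop) hint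
    (g := fun i => i + 1) (add_left_injective 1)
  rw [integral_sq_gaussianReal] at hae
  have hmeas : ∀ n : ℕ, Measurable fun ω : ℕ → ℝ =>
      ω 0 / √((∑ i ∈ Finset.range n, ω (i + 1) ^ 2) / n) := fun n => by fun_prop
  have hlim := TendstoInMeasure.tendstoInDistribution_of_aemeasurable
    (tendstoInMeasure_of_tendsto_ae (f := fun (n : ℕ) (ω : ℕ → ℝ) =>
        ω 0 / √((∑ i ∈ Finset.range n, ω (i + 1) ^ 2) / n)) (g := fun ω : ℕ → ℝ => ω 0)
      (fun n => (hmeas n).aestronglyMeasurable) (by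
        filter_upwards [hae] with ω hω
        have h0 := (tendsto_const_nhds (x := ω 0)).div hω.sqrt (by simp)
        rw [Real.sqrt_one, div_one] at h0
        exact h0))
    (fun n => (hmeas n).aemeasurable) (measurable_pi_apply 0).aemeasurable
  simp_rw [studentT_eq_map_infinitePi]
  refine TendstoInDistribution.eventually_measureReal_lt hlim isClosed_Icc ?_
  rwa [Measure.infinitePi_map_eval (fun _ : ℕ => gaussianReal 0 1) 0]

/-- Asymptotically, the critical values of the t-distribution are at least those of the standard
normal distribution. -/
theorem eventually_le_tCritical {α c : ℝ} (hα : 0 < α)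
    (h : (gaussianReal 0 1).real (Set.Icc (-c) c) < 1 - α) :
    ∀ᶠ n in atTop, c ≤ tCritical n α := by
  filter_upwards [eventually_studentT_Icc_lt h] with n hn
  refine le_csInf ?_ ?_
  -- Nonemptiness matters: the infimum of the empty set would be `0`.
  · obtain ⟨b, hb⟩ := (((tendsto_measureReal_Icc_neg (studentT n)).eventually
      (lt_mem_nhds (show 1 - α < 1 by linarith))).and (eventually_ge_atTop 0)).exists
    exact ⟨b, hb.2, hb.1.le⟩
  · rintro b ⟨-, hb⟩
    by_contra! hbc
    have := measureReal_mono (μ := studentT n) (Set.Icc_subset_Icc (neg_le_neg hbc.le) hbc.le)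
    linarith

/-! ### Sample statistics. -/

theorem measurable_sampleMean (N : ℕ) : Measurable (sampleMean (N := N)) := by
  unfold sampleMean
  fun_prop

theorem measurable_sampleStdDev (N : ℕ) : Measurable (sampleStdDev (N := N)) := by
  have := measurable_sampleMean N
  unfold sampleStdDev
  fun_prop

theorem measurable_lowerConfidenceLimit (N : ℕ) (α : ℝ) :
    Measurable (lowerConfidenceLimit (N := N) α) := by
  have := measurable_sampleMean N
  have := measurable_sampleStdDev N
  unfold lowerConfidenceLimit
  fun_prop

theorem sampleMean_neg {N : ℕ} (y : Fin N → ℝ) : sampleMean (fun i => -y i) = -sampleMean y := by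
  simp [sampleMean, neg_div]

theorem sampleStdDev_neg {N : ℕ} (y : Fin N → ℝ) :
    sampleStdDev (fun i => -y i) = sampleStdDev y := by
  have : ∀ i, (-y i - -sampleMean y) ^ 2 = (y i - sampleMean y) ^ 2 := fun i => by ring
  simp only [sampleStdDev, sampleMean_neg, this]

theorem lowerConfidenceLimit_neg {N : ℕ} (α : ℝ) (y : Fin N → ℝ) :
    lowerConfidenceLimit α (fun i => -y i) = -upperConfidenceLimit α y := by
  rw [lowerConfidenceLimit, upperConfidenceLimit, sampleMean_neg, sampleStdDev_neg]
  ring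

theorem sampleStdDev_eq {N : ℕ} (hN : N ≠ 0) (y : Fin N → ℝ) :
    sampleStdDev y =
      √((N / ((N : ℝ) - 1)) * ((∑ i, y i ^ 2) / N - ((∑ i, y i) / N) ^ 2)) := by
  have hN' : (N : ℝ) ≠ 0 := Nat.cast_ne_zero.2 hN
  have h : ∑ i, (y i - sampleMean y) ^ 2 =
      N * ((∑ i, y i ^ 2) / N - ((∑ i, y i) / N) ^ 2) := by
    simp only [sub_sq, Finset.sum_add_distrib, Finset.sum_sub_distrib, ← Finset.sum_mul,
      ← Finset.mul_sum, Finset.sum_const, Finset.card_univ, Fintype.card_fin, nsmul_eq_mul,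
      sampleMean]
    field_simp
    ring
  rw [sampleStdDev, h]
  congr 1
  ring

theorem lowerConfidenceLimit_const {N : ℕ} (hN : N ≠ 0) (α m : ℝ) :
    lowerConfidenceLimit α (fun _ : Fin N => m) = m := by
  have hN' : (N : ℝ) ≠ 0 := Nat.cast_ne_zero.2 hN
  have hm : sampleMean (fun _ : Fin N => m) = m := by simp [sampleMean, hN']
  simp [lowerConfidenceLimit, sampleStdDev, hm]

theorem tendsto_sampleStdDev_infinitePi (ν : Measure ℝ) [IsProbabilityMeasure ν]
    (hν : MemLp id 2 ν) :
    ∀ᵐ ω ∂(Measure.infinitePi fun _ : ℕ => ν),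
      Tendsto (fun n : ℕ => sampleStdDev fun i : Fin n => ω i) atTop (𝓝 √(Var[id; ν])) := by
  have hid : Integrable (fun x : ℝ => x) ν := hν.integrable one_le_two
  filter_upwards [strong_law_infinitePi ν (f := fun x => x) measurable_id hid
      (g := fun i => i) (fun _ _ h => h),
    strong_law_infinitePi ν (f := fun x => x ^ 2) (by fun_prop) hν.integrable_sq
      (g := fun i => i) (fun _ _ h => h)] with ω h1 h2
  have hratio : Tendsto (fun n : ℕ => (n : ℝ) / ((n : ℝ) - 1)) atTop (𝓝 1) := by
    simpa [sub_eq_add_neg] using tendsto_natCast_div_add_atTop (-1 : ℝ)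
  have hlim := (hratio.mul (h2.sub (h1.pow 2))).sqrt
  rw [variance_eq_sub hν]
  simp only [one_mul] at hlim
  refine Tendsto.congr' ?_ hlim
  filter_upwards [eventually_ne_atTop 0] with n hn
  rw [sampleStdDev_eq hn, Fin.sum_univ_eq_sum_range (fun i => ω i ^ 2),
    Fin.sum_univ_eq_sum_range (fun i => ω i)]

/-! ### Asymptotic coverage of the one-sided t-interval. -/

theorem measureReal_pi_eq_infinitePi (ν : Measure ℝ) [IsProbabilityMeasure ν] {N : ℕ}
    {s : Set (Fin N → ℝ)} (hs : MeasurableSet s) :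
    (Measure.pi fun _ : Fin N => ν).real s =
      (Measure.infinitePi fun _ : ℕ => ν).real {ω | (fun i : Fin N => ω i) ∈ s} := by
  rw [← infinitePi_map_fin, map_measureReal_apply (by fun_prop) hs]
  rfl

/-- A separate case: the limit law would be a point mass at `0`, on the boundary of the closed
half-line used below. Here the sample is almost surely constant and the limit equals the mean. -/
theorem eventually_lowerConfidenceLimit_of_variance_eq_zero (ν : Measure ℝ)
    [IsProbabilityMeasure ν] (hν : MemLp id 2 ν) (hv : Var[id; ν] = 0) (α : ℝ) :
    ∀ᶠ N : ℕ in atTop,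
      (Measure.pi fun _ : Fin N => ν).real {y | ∫ x, x ∂ν < lowerConfidenceLimit α y} = 0 := by
  filter_upwards [eventually_ne_atTop 0] with N hN
  have hae : ∀ᵐ x ∂ν, x = ∫ x, x ∂ν := ae_eq_integral_of_variance_eq_zero hν hv
  have hall : ∀ᵐ y ∂(Measure.pi fun _ : Fin N => ν), ∀ i, y i = ∫ x, x ∂ν :=
    ae_all_iff.2 fun i => (measurePreserving_eval (fun _ : Fin N => ν) i).quasiMeasurePreserving.ae hae
  rw [measureReal_eq_zero_iff]
  refine measure_mono_null ?_ hall
  intro y hy hy'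
  simp only [Set.mem_ofPred_eq] at hy hy'
  rw [funext hy', lowerConfidenceLimit_const hN] at hy
  exact lt_irrefl _ hy

theorem tendstoInDistribution_sum_infinitePi (ν : Measure ℝ) [IsProbabilityMeasure ν]
    (hν : MemLp id 2 ν) :
    TendstoInDistribution
      (fun (n : ℕ) (ω : ℕ → ℝ) =>
        (√n)⁻¹ * (∑ k ∈ Finset.range n, ω k - n * ∫ x, x ∂ν))
      atTop (fun z => √(Var[id; ν]) * z) (fun _ => Measure.infinitePi fun _ : ℕ => ν)
      (gaussianReal 0 1) := by
  have hident0 : IdentDistrib (fun ω : ℕ → ℝ => ω 0) id (Measure.infinitePi fun _ : ℕ => ν) ν :=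
    ⟨(measurable_pi_apply 0).aemeasurable, aemeasurable_id,
      by rw [Measure.infinitePi_map_eval, Measure.map_id]⟩
  have hind : iIndepFun (fun (i : ℕ) (ω : ℕ → ℝ) => ω i) (Measure.infinitePi fun _ : ℕ => ν) :=
    iIndepFun_infinitePi (X := fun _ x => x) fun _ => measurable_id
  have hlaw : HasLaw (fun z => √(Var[id; ν]) * z)
      (gaussianReal 0 (Var[fun ω : ℕ → ℝ => ω 0; Measure.infinitePi fun _ : ℕ => ν]).toNNReal)
      (gaussianReal 0 1) := by
    refine ⟨by fun_prop, ?_⟩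
    have hvar : NNReal.mk (√(Var[id; ν]) ^ 2) (sq_nonneg _) * 1 = (Var[id; ν]).toNNReal := by
      ext
      simp [Real.sq_sqrt, variance_nonneg]
    rw [gaussianReal_map_const_mul, hident0.variance_eq, mul_zero, hvar]
  have h := tendstoInDistribution_inv_sqrt_mul_sum_sub
    (X := fun (i : ℕ) (ω : ℕ → ℝ) => ω i) hlaw (hident0.memLp_iff.2 hν) hind
    fun i => identDistrib_eval_infinitePi ν (f := fun x => x) measurable_id i 0
  have hmean := integral_eval_infinitePi ν (f := fun x => x) measurable_id 0
  simp only [hmean] at h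
  exact h

/-- Replaces the varying critical value by a fixed `c` and avoids dividing by the sample deviation,
which may vanish. -/
theorem le_of_lt_lowerConfidenceLimit {N : ℕ} (hN : N ≠ 0) {α c m : ℝ}
    (hc : c ≤ tCritical (N - 1) α) {y : Fin N → ℝ} (h : m < lowerConfidenceLimit α y) :
    0 ≤ (√N)⁻¹ * (∑ i, y i - N * m) - c * sampleStdDev y := by
  have hN' : (0 : ℝ) < N := Nat.cast_pos.2 (Nat.pos_of_ne_zero hN)
  have hsq : (0 : ℝ) < √N := Real.sqrt_pos.2 hN'
  have hcs := mul_le_mul_of_nonneg_right hc (show 0 ≤ sampleStdDev y from Real.sqrt_nonneg _)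
  have hmean : (√N)⁻¹ * (∑ i, y i - N * m) = √N * (sampleMean y - m) := by
    rw [sampleMean]
    field_simp
    rw [Real.sq_sqrt hN'.le]
  have hstd : √N * (tCritical (N - 1) α * (sampleStdDev y / √N)) =
      tCritical (N - 1) α * sampleStdDev y := by
    field_simp
  rw [lowerConfidenceLimit, lt_sub_comm] at h
  have := mul_lt_mul_of_pos_left h hsq
  linarith

theorem eventually_lowerConfidenceLimit_of_variance_ne_zero (ν : Measure ℝ)
    [IsProbabilityMeasure ν] (hν : MemLp id 2 ν) (hv : Var[id; ν] ≠ 0) {α : ℝ} (hα₀ : 0 < α)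
    (hα₁ : α < 1) {ε : ℝ} (hε : 0 < ε) :
    ∀ᶠ N : ℕ in atTop,
      (Measure.pi fun _ : Fin N => ν).real {y | ∫ x, x ∂ν < lowerConfidenceLimit α y} ≤
        α / 2 + ε := by
  -- A level strictly below `1 - α` gives `c ≤ tCritical` eventually; the upper tail beyond `c` is
  -- at most `(α + ε) / 2`. The maximum covers large `ε`.
  obtain ⟨c, hc, hcp⟩ := exists_gaussianReal_Icc_eq (p := max 0 (1 - α - ε)) (le_max_left _ _)
    (max_lt one_pos (by linarith))
  have hclt : (gaussianReal 0 1).real (Set.Icc (-c) c) < 1 - α := by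
    rw [hcp]
    exact max_lt (by linarith) (by linarith)
  have hσ : 0 < √(Var[id; ν]) := Real.sqrt_pos.2 ((variance_nonneg _ _).lt_of_ne' hv)
  have hSmeas : ∀ n : ℕ, Measurable fun ω : ℕ → ℝ => sampleStdDev fun i : Fin n => ω i :=
    fun n => (measurable_sampleStdDev n).comp (by fun_prop)
  have hS := tendstoInMeasure_of_tendsto_ae (fun n => (hSmeas n).aestronglyMeasurable)
    (tendsto_sampleStdDev_infinitePi ν hν)
  -- Slutsky: the limit is `σ * z - c * σ`, nonnegative exactly when `c ≤ z`.
  have hlim :=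
    (tendstoInDistribution_sum_infinitePi ν hν).continuous_comp_prodMk_of_tendstoInMeasure_const
      (g := fun p : ℝ × ℝ => p.1 - c * p.2) (by fun_prop) hS (fun n => (hSmeas n).aemeasurable)
  generalize √(Var[id; ν]) = σ at hσ hlim
  have hlimit : ((gaussianReal 0 1).map fun z => σ * z - c * σ).real (Set.Ici 0) <
      α / 2 + ε := by
    have hpre : (fun z => σ * z - c * σ) ⁻¹' Set.Ici 0 = Set.Ici c := by
      ext z
      simp only [Set.mem_preimage, Set.mem_Ici, sub_nonneg]
      rw [mul_comm c σ, mul_le_mul_iff_right₀ hσ]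
    rw [map_measureReal_apply (by fun_prop) measurableSet_Ici, hpre, gaussianReal_Ici_eq hc, hcp]
    have := le_max_right 0 (1 - α - ε)
    linarith
  filter_upwards [TendstoInDistribution.eventually_measureReal_lt hlim isClosed_Ici hlimit,
    (tendsto_sub_atTop_nat 1).eventually (eventually_le_tCritical hα₀ hclt),
    eventually_ne_atTop 0] with N hN ht hN0
  rw [measureReal_pi_eq_infinitePi ν
    (measurableSet_lt measurable_const (measurable_lowerConfidenceLimit N α))]
  rw [map_measureReal_apply_of_aemeasurable (hlim.forall_aemeasurable N)
    measurableSet_Ici] at hN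
  refine (measureReal_mono ?_).trans hN.le
  intro ω hω
  have h := le_of_lt_lowerConfidenceLimit hN0 ht hω
  rwa [Fin.sum_univ_eq_sum_range (fun i => ω i)] at h

/-- The one-sided t-interval for the mean of a square-integrable law has asymptotic
non-coverage probability at most `α / 2`. -/
theorem eventually_lowerConfidenceLimit (ν : Measure ℝ)
    [IsProbabilityMeasure ν] (hν : MemLp id 2 ν) {α : ℝ} (hα₀ : 0 < α)
    (hα₁ : α < 1) {ε : ℝ} (hε : 0 < ε) :
    ∀ᶠ N : ℕ in atTop,
      (Measure.pi fun _ : Fin N => ν).real {y | ∫ x, x ∂ν < lowerConfidenceLimit α y} ≤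
        α / 2 + ε := by
  by_cases hv : Var[id; ν] = 0
  · filter_upwards [eventually_lowerConfidenceLimit_of_variance_eq_zero ν hν hv α] with N hN
    rw [hN]
    positivity
  · exact eventually_lowerConfidenceLimit_of_variance_ne_zero ν hν hv hα₀ hα₁ hε

theorem eventually_lowerConfidenceLimit_comp {E : Type*} [MeasurableSpace E] (ρ : Measure E)
    [IsProbabilityMeasure ρ] {f : E → ℝ} (hf : Measurable f) {C : ℝ} (hC : ∀ x, |f x| ≤ C)
    {α : ℝ} (hα₀ : 0 < α) (hα₁ : α < 1) {ε : ℝ} (hε : 0 < ε) :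
    ∀ᶠ N : ℕ in atTop,
      (Measure.pi fun _ : Fin N => ρ).real
        {z | ∫ x, f x ∂ρ < lowerConfidenceLimit α fun i => f (z i)} ≤ α / 2 + ε := by
  have : IsProbabilityMeasure (ρ.map f) := Measure.isProbabilityMeasure_map hf.aemeasurable
  have hLp : MemLp id 2 (ρ.map f) :=
    (memLp_map_measure_iff aestronglyMeasurable_id hf.aemeasurable).2
      (MemLp.of_bound hf.aestronglyMeasurable C (ae_of_all _ hC))
  filter_upwards [eventually_lowerConfidenceLimit (ρ.map f) hLp hα₀ hα₁ hε] with N hN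
  rw [integral_map (f := fun x => x) hf.aemeasurable aestronglyMeasurable_id,
    ← Measure.pi_map_pi fun _ => hf.aemeasurable,
    map_measureReal_apply (by fun_prop)
      (measurableSet_lt measurable_const (measurable_lowerConfidenceLimit N α))] at hN
  exact hN

/-! ### Application to the two estimators. -/

/-- The law of the pairs depends only on `μ`, so one `N₀` serves every probability space. -/
theorem ProbabilityTheory.iIndepFun.map_prodMk_eq_pi {𝒳 Ω ι : Type*} [Fintype ι] [MeasurableSpace 𝒳]
    [MeasurableSpace Ω]
    {P : Measure Ω} [IsProbabilityMeasure P] {μ : Measure 𝒳} [IsProbabilityMeasure μ]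
    {χ χ' : ι → Ω → 𝒳} (hm : ∀ i, AEMeasurable (χ i) P) (hm' : ∀ i, AEMeasurable (χ' i) P)
    (hχ : ∀ i, P.map (χ i) = μ) (hχ' : ∀ i, P.map (χ' i) = μ)
    (hind : iIndepFun (Sum.elim χ χ') P) :
    P.map (fun ω i => (χ i ω, χ' i ω)) = Measure.pi fun _ : ι => μ.prod μ := by
  have hme : ∀ j, AEMeasurable (Sum.elim χ χ' j) P := by
    rintro (i | i)
    exacts [hm i, hm' i]
  rw [iIndepFun_iff_map_fun_eq_pi_map hme] at hind
  have hlaw : (fun j => P.map (Sum.elim χ χ' j)) = fun _ : ι ⊕ ι => μ := by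
    funext j
    rcases j with i | i
    exacts [hχ i, hχ' i]
  rw [hlaw] at hind
  have h1 := measurePreserving_sumPiEquivProdPi (X := fun _ : ι ⊕ ι => 𝒳) fun _ => μ
  have h2 := (measurePreserving_arrowProdEquivProdArrow 𝒳 𝒳 ι (fun _ => μ) (fun _ => μ)).symm
  have h3 := (h2.comp h1).map_eq
  rw [← hind, AEMeasurable.map_map_of_aemeasurable (h2.comp h1).measurable.aemeasurable
    (aemeasurable_pi_lambda _ hme)] at h3
  exact h3

theorem mainTheorem3
    {𝒳 : Type*} [MeasurableSpace 𝒳]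
    {k : ℕ} (T : Set (EuclideanSpace ℝ (Fin k))) (hT : IsCompact T)
    {Ω₀ : Type*} [MeasurableSpace Ω₀] (P₀ : Measure Ω₀) [IsProbabilityMeasure P₀]
    (X : Ω₀ → 𝒳) (hX : Measurable X)
    (θhat : 𝒳 → T → ℝ)
    (hmeas : ∀ t, Measurable fun x => θhat x t)
    (hcont : ∀ x, Continuous (θhat x))
    (hbdd : BddAbove (Set.range fun p : 𝒳 × T => |θhat p.1 p.2|))
    (θ : T → ℝ) (hunbiased : ∀ t, ∫ ω, θhat (X ω) t ∂P₀ = θ t)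
    (θstar : ℝ) (hθstar : IsLeast (Set.range θ) θstar)
    (τ : 𝒳 → T) (hτmeas : Measurable τ) (hτ : ∀ x t, θhat x (τ x) ≤ θhat x t)
    (α : ℝ) (hα₀ : 0 < α) (hα₁ : α < 1) :
    ∀ ε : ℝ, 0 < ε → ∃ N₀ : ℕ, ∀ N ≥ N₀,
      ∀ {Ω : Type*} [MeasurableSpace Ω] (P : Measure Ω) [IsProbabilityMeasure P]
        (χ χ' : Fin N → Ω → 𝒳),
        (∀ i, IdentDistrib (χ i) X P P₀) → (∀ i, IdentDistrib (χ' i) X P P₀) →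
        iIndepFun (Sum.elim χ χ') P →
        1 - α - ε ≤
          P.real {ω |
            lowerConfidenceLimit α (fun i => lowerEstimator θhat τ (χ i ω)) ≤ θstar ∧
            θstar ≤ upperConfidenceLimit α
              (fun i => upperEstimator θhat τ (χ i ω) (χ' i ω))} := by
  intro ε hε
  obtain ⟨C, hC⟩ := hbdd
  replace hC : ∀ x t, |θhat x t| ≤ C := fun x t => hC ⟨(x, t), rfl⟩
  have hjoint : Measurable fun p : 𝒳 × T => θhat p.1 p.2 :=
    (measurable_uncurry_of_continuous_of_measurable (u := fun t x => θhat x t) hcont hmeas).comp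
      measurable_swap
  set μ := P₀.map X with hμ
  have : IsProbabilityMeasure μ := Measure.isProbabilityMeasure_map hX.aemeasurable
  have hθ : ∀ t, ∫ x, θhat x t ∂μ = θ t := fun t => by
    rw [hμ, integral_map hX.aemeasurable (hmeas t).aestronglyMeasurable, hunbiased]
  let f : 𝒳 × 𝒳 → ℝ := fun p => θhat p.1 (τ p.1)
  -- The sign turns the upper limit into a lower one, by `lowerConfidenceLimit_neg`.
  let g : 𝒳 × 𝒳 → ℝ := fun p => -θhat p.1 (τ p.2)
  have hf : Measurable f := hjoint.comp (measurable_fst.prodMk (hτmeas.comp measurable_fst))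
  have hg : Measurable g :=
    (hjoint.comp (measurable_fst.prodMk (hτmeas.comp measurable_snd))).neg
  have hgC : ∀ p, |g p| ≤ C := fun p => by simpa [g] using hC p.1 (τ p.2)
  have hfint : Integrable f (μ.prod μ) :=
    Integrable.of_bound hf.aestronglyMeasurable C (ae_of_all _ fun p => hC _ _)
  have hgint : Integrable g (μ.prod μ) :=
    Integrable.of_bound hg.aestronglyMeasurable C (ae_of_all _ hgC)
  have hfmean : ∫ p, f p ∂(μ.prod μ) ≤ θstar := by
    obtain ⟨t, ht⟩ := hθstar.1
    have hint : Integrable (fun p : 𝒳 × 𝒳 => θhat p.1 t) (μ.prod μ) :=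
      Integrable.of_bound ((hmeas t).comp measurable_fst).aestronglyMeasurable C
        (ae_of_all _ fun p => hC _ _)
    calc ∫ p, f p ∂(μ.prod μ) ≤ ∫ p, θhat p.1 t ∂(μ.prod μ) :=
          integral_mono hfint hint fun p => hτ _ _
      _ = θstar := by
          rw [integral_fun_fst (fun x => θhat x t), hθ, ht]
          simp
  have hgmean : ∫ p, g p ∂(μ.prod μ) ≤ -θstar := by
    rw [integral_prod_symm _ hgint]
    have hle : ∀ y, ∫ x, g (x, y) ∂μ ≤ -θstar := fun y => by
      simp only [g, integral_neg, hθ]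
      exact neg_le_neg (hθstar.2 ⟨_, rfl⟩)
    calc ∫ y, ∫ x, g (x, y) ∂μ ∂μ ≤ ∫ _, -θstar ∂μ :=
          integral_mono hgint.integral_prod_right (integrable_const _) hle
      _ = -θstar := by simp
  obtain ⟨N₀, hN₀⟩ := eventually_atTop.1
    ((eventually_lowerConfidenceLimit_comp (μ.prod μ) hf (fun p => hC _ _) hα₀ hα₁
      (half_pos hε)).and
    (eventually_lowerConfidenceLimit_comp (μ.prod μ) hg hgC hα₀ hα₁ (half_pos hε)))
  refine ⟨N₀, fun N hN Ω _ P _ χ χ' hχ hχ' hind => ?_⟩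
  obtain ⟨hlow, hup⟩ := hN₀ N hN
  have hm := fun i => (hχ i).aemeasurable_fst
  have hm' := fun i => (hχ' i).aemeasurable_fst
  have hlaw := iIndepFun.map_prodMk_eq_pi hm hm' (fun i => (hχ i).map_eq)
    (fun i => (hχ' i).map_eq) hind
  have hpair : AEMeasurable (fun ω i => (χ i ω, χ' i ω)) P :=
    aemeasurable_pi_lambda _ fun i => (hm i).prodMk (hm' i)
  have hset : ∀ {h : 𝒳 × 𝒳 → ℝ}, Measurable h → MeasurableSet
      {z : Fin N → 𝒳 × 𝒳 | ∫ p, h p ∂(μ.prod μ) < lowerConfidenceLimit α fun i => h (z i)} :=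
    fun {h} hh => measurableSet_lt measurable_const
      ((measurable_lowerConfidenceLimit N α).comp (by fun_prop))
  rw [← hlaw, map_measureReal_apply_of_aemeasurable hpair (hset hf)] at hlow
  rw [← hlaw, map_measureReal_apply_of_aemeasurable hpair (hset hg)] at hup
  set S := {ω | lowerConfidenceLimit α (fun i => lowerEstimator θhat τ (χ i ω)) ≤ θstar ∧
    θstar ≤ upperConfidenceLimit α (fun i => upperEstimator θhat τ (χ i ω) (χ' i ω))} with hS
  set A := (fun ω i => (χ i ω, χ' i ω)) ⁻¹'
    {z : Fin N → 𝒳 × 𝒳 | ∫ p, f p ∂(μ.prod μ) < lowerConfidenceLimit α fun i => f (z i)} with hA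
  set B := (fun ω i => (χ i ω, χ' i ω)) ⁻¹'
    {z : Fin N → 𝒳 × 𝒳 | ∫ p, g p ∂(μ.prod μ) < lowerConfidenceLimit α fun i => g (z i)} with hB
  have hcover : (Set.univ : Set Ω) ⊆ S ∪ (A ∪ B) := by
    intro ω _
    by_contra hω
    simp only [Set.mem_union, not_or] at hω
    obtain ⟨hωS, hωA, hωB⟩ := hω
    have h1 : lowerConfidenceLimit α (fun i => lowerEstimator θhat τ (χ i ω)) ≤
        ∫ p, f p ∂(μ.prod μ) := not_lt.1 hωA
    have h2 : lowerConfidenceLimit α (fun i => -upperEstimator θhat τ (χ i ω) (χ' i ω)) ≤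
        ∫ p, g p ∂(μ.prod μ) := not_lt.1 hωB
    rw [lowerConfidenceLimit_neg] at h2
    exact hωS ⟨h1.trans hfmean, by linarith⟩
  have h1 := measureReal_mono (μ := P) hcover
  have h2 := measureReal_union_le (μ := P) S (A ∪ B)
  have h3 := measureReal_union_le (μ := P) A B
  rw [probReal_univ] at h1
  linarith
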